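/- Let $\mathcal G=(\mathcal V,\mathcal E)$ be a finite, weakly connected directed multigraph without self-loops, with at least two nodes; write $\sigma(i)$ and $\tau(i)$ for the tail and head of a link $i$, and let $A\in\{-1,0,1\}^{\mathcal V\times\mathcal E}$ be the incidence matrix, with $A_{vi}=1$ if $v=\sigma(i)$, $A_{vi}=-1$ if $v=\tau(i)$, and $A_{vi}=0$ otherwise. For weights $w\in\mathbb R_{\ge 0}^{\mathcal E}$, with $W=\operatorname{diag}(w)$ and $L=AWA^T$, and for $p\in\mathbb R^{\mathcal V}$, put $f(w,p)=WA^TL^{\dagger}p$, where $L^\dagger$ is the Moore–Penrose pseudo-inverse. Say that $p$ can be served with $w$ if the DC power flow equations $Af=p$, $f=WA^T\phi$ have a solution $(f,\phi)$; then $f=f(w,p)$ is the only possible flow. (If $w>0$, every $p$ with $\mathbf 1^Tp=0$ can be served with $w$.) Let $w^l\in\mathbb R_{\ge0}^{\mathcal E}$, $w^u\in\mathbb R_{>0}^{\mathcal E}$, $c^l\in\mathbb R_{<0}^{\mathcal E}$, $c^u\in\mathbb R_{>0}^{\mathcal E}$, let $p_0\in\mathbb R^{\mathcal V}$ satisfy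 $\mathbf 1^Tp_0=0$, and let $w_0\in[w^l,w^u]$ be initial weights with which $p_0$ can be served (in particular, any $w_0\in[w^l,w^u]$ with $w_0>0$). Assume that the initial flow $f_0=f(w_0,p_0)$ satisfies $c^l\le f_0\le c^u$. For $\delta\in\mathbb R^{\mathcal V}$ let $\nu(\delta)$ be the supremum of all $\mu\ge0$ for which there is a $w$ with $w^l\le w\le w^u$ such that $p_0+\mu\delta$ can be served with $w$ and $c^l\le f(w,p_0+\mu\delta)\le c^u$. The centralized margin of robustness is $$\nu^*(\mathcal G)=\inf\{\nu(\delta):\ \|\delta\|_1=1,\ \mathbf 1^T\delta=0\}.$$ The associated flow network $(\mathcal G^{\mathrm{fl}},c^{\mathrm{fl}})$ has node set $\mathcal V$; its links are all links $i\in\mathcal E$, with capacity $c^u_i-f_{0,i}$, together with a reversed copy of each link $i\in\mathcal E$, with capacity $-c^l_i+f_{0,i}$. Its min-cut capacity is $$C_{\min}(\mathcal G^{\mathrm{fl}},c^{\mathrm{fl}})=\min_{\emptyset\subsetneq S\subsetneq\mathcal V}\ \sum_{j:\ \sigma(j)\in S,\ \tau(j)\notin S}c^{\mathrm{fl}}_j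 ,$$ the sum being over links $j$ of $\mathcal G^{\mathrm{fl}}$. Then $$\nu^*(\mathcal G)\le 2\,C_{\min}(\mathcal G^{\mathrm{fl}},c^{\mathrm{fl}}).$$ Moreover, if $\mathcal G$ is a tree (as an undirected multigraph) or $w^l=\mathbf 0$, then $\nu^*(\mathcal G)=2\,C_{\min}(\mathcal G^{\mathrm{fl}},c^{\mathrm{fl}})$. In particular, if $\mathcal G$ is a tree, then $$\nu^*(\mathcal G)=2\min_{i\in\mathcal E}\min\{f_{0,i}-c^l_i,\ c^u_i-f_{0,i}\}.$$ -/

import Mathlib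

open Matrix

/-- `X` is the Moore-Penrose pseudo-inverse of the real matrix `M`: the four Penrose equations. -/
def IsMoorePenrose {m n : Type*} [Fintype m] [Fintype n]
    (M : Matrix m n ℝ) (X : Matrix n m ℝ) : Prop :=
  M * X * M = M ∧ X * M * X = X ∧ (M * X)ᵀ = M * X ∧ (X * M)ᵀ = X * M

theorem IsMoorePenrose.unique {m n : Type*} [Fintype m] [Fintype n]
    {M : Matrix m n ℝ} {X Y : Matrix n m ℝ}
    (hX : IsMoorePenrose M X) (hY : IsMoorePenrose M Y) : X = Y := by
  obtain ⟨x1, x2, x3, x4⟩ := hX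
  obtain ⟨y1, y2, y3, y4⟩ := hY
  have hMX : M * X = M * Y := by
    calc M * X = (M * Y * M) * X := by rw [y1]
      _ = (M * Y)ᵀ * (M * X)ᵀ := by rw [y3, x3]; simp only [Matrix.mul_assoc]
      _ = ((M * X * M) * Y)ᵀ := by rw [← Matrix.transpose_mul]; simp only [Matrix.mul_assoc]
      _ = M * Y := by rw [x1, y3]
  have hXM : X * M = Y * M := by
    calc X * M = X * (M * Y * M) := by rw [y1]
      _ = (X * M)ᵀ * (Y * M)ᵀ := by rw [y4, x4]; simp only [Matrix.mul_assoc]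
      _ = (Y * (M * X * M))ᵀ := by rw [← Matrix.transpose_mul]; simp only [Matrix.mul_assoc]
      _ = Y * M := by rw [x1, y4]
  calc X = X * M * X := x2.symm
    _ = Y * M * X := by rw [hXM]
    _ = Y * (M * X) := by rw [Matrix.mul_assoc]
    _ = Y * M * Y := by rw [hMX, Matrix.mul_assoc]
    _ = Y := y2

theorem exists_isMoorePenrose {m n : Type*} [Fintype m] [Fintype n]
    (M : Matrix m n ℝ) : ∃ X, IsMoorePenrose M X := by
  classical
  set S : Matrix n n ℝ := Mᵀ * M with hS
  have hSH : IsSelfAdjoint S := by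
    rw [hS]
    simp [IsSelfAdjoint, Matrix.star_eq_conjTranspose]
  set T : Matrix n n ℝ := cfc (fun x : ℝ => x⁻¹) S with hT
  have hfin : (spectrum ℝ S).Finite := Matrix.finite_real_spectrum
  have hc : ∀ g : ℝ → ℝ, ContinuousOn g (spectrum ℝ S) := fun g => hfin.continuousOn g
  have hTT : Tᵀ = T := by
    have h : IsSelfAdjoint T := cfc_predicate (R := ℝ) (fun x : ℝ => x⁻¹) S
    simpa [IsSelfAdjoint, Matrix.star_eq_conjTranspose] using h
  have hST : S * T = cfc (fun x : ℝ => x * x⁻¹) S := by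
    rw [cfc_mul (fun x : ℝ => x) (fun x => x⁻¹) S (hc _) (hc _), cfc_id' ℝ S]
  have hTS : T * S = cfc (fun x : ℝ => x⁻¹ * x) S := by
    rw [cfc_mul (fun x : ℝ => x⁻¹) (fun x => x) S (hc _) (hc _), cfc_id' ℝ S]
  have hcomm : T * S = S * T := by
    rw [hTS, hST]; congr 1; funext x; ring
  have hSTS : S * T * S = S := by
    have : S * T * S = cfc (fun x : ℝ => x * x⁻¹ * x) S := by
      rw [cfc_mul (fun x : ℝ => x * x⁻¹) (fun x => x) S (hc _) (hc _), ← hST, cfc_id' ℝ S]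
    rw [this]
    simp only [mul_inv_mul_cancel]
    exact cfc_id' ℝ S
  have hTST : T * S * T = T := by
    have : T * S * T = cfc (fun x : ℝ => x⁻¹ * x * x⁻¹) S := by
      rw [cfc_mul (fun x : ℝ => x⁻¹ * x) (fun x => x⁻¹) S (hc _) (hc _), ← hTS]
    rw [this, hT]
    congr 1; funext x
    by_cases hx : x = 0 <;> simp [hx]
  have hkey : M * (T * S) = M := by
    have h0 : Mᵀ * (M * (T * S) - M) = 0 := by
      rw [Matrix.mul_sub, ← Matrix.mul_assoc, ← hS, ← Matrix.mul_assoc, hSTS, sub_self]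
    have h1 : (M * (T * S) - M)ᵀ * (M * (T * S) - M) = 0 := by
      have : (M * (T * S) - M)ᵀ = (T * S - 1)ᵀ * Mᵀ := by
        rw [← Matrix.transpose_mul, Matrix.mul_sub, Matrix.mul_one]
      rw [this, Matrix.mul_assoc, h0, Matrix.mul_zero]
    have h2 : (M * (T * S) - M)ᴴ * (M * (T * S) - M) = 0 := by
      simpa using h1
    exact sub_eq_zero.mp (Matrix.conjTranspose_mul_self_eq_zero.mp h2)
  refine ⟨T * Mᵀ, ?_, ?_, ?_, ?_⟩
  · rw [Matrix.mul_assoc, Matrix.mul_assoc, ← hS, hkey]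
  · rw [Matrix.mul_assoc T, ← hS, ← Matrix.mul_assoc, hTST]
  · simp only [Matrix.transpose_mul, Matrix.transpose_transpose, hTT, Matrix.mul_assoc]
  · rw [Matrix.mul_assoc, ← hS, Matrix.transpose_mul, hTT]
    have : Sᵀ = S := by rw [hS]; simp
    rw [this, hcomm]

/-- The Moore-Penrose pseudo-inverse `M†`. -/
noncomputable def moorePenrose {m n : Type*} [Fintype m] [Fintype n]
    (M : Matrix m n ℝ) : Matrix n m ℝ :=
  (exists_isMoorePenrose M).choose

/-- A directed multigraph with node set `V` and link set `E`, without self-loops;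
`tail i` is `σ(i)` and `head i` is `τ(i)`. -/
structure DiMultigraph (V E : Type*) where
  tail : E → V
  head : E → V
  tail_ne_head : ∀ i, tail i ≠ head i

namespace DiMultigraph

variable {V E : Type*}

/-- The simple graph on the nodes obtained by forgetting directions and multiplicities. -/
def underlying (G : DiMultigraph V E) : SimpleGraph V where
  Adj u v := ∃ i, (G.tail i = u ∧ G.head i = v) ∨ (G.tail i = v ∧ G.head i = u)
  symm := ⟨fun _ _ ⟨i, h⟩ => ⟨i, h.symm⟩⟩
  loopless := ⟨fun _ ⟨i, h⟩ => by
    rcases h with ⟨h1, h2⟩ | ⟨h1, h2⟩ <;> exact G.tail_ne_head i (h1.trans h2.symm)⟩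

def WeaklyConnected (G : DiMultigraph V E) : Prop := G.underlying.Connected

/-- The undirected multigraph is a tree: connected, without cycles, and in particular without
parallel or antiparallel links (two of which would form a cycle). -/
def IsTree (G : DiMultigraph V E) : Prop :=
  G.underlying.IsTree ∧ Function.Injective fun i => s(G.tail i, G.head i)

/-- The node-link incidence matrix: `+1` at the tail and `-1` at the head of each link. -/
def incidence [DecidableEq V] (G : DiMultigraph V E) : Matrix V E ℝ :=
  Matrix.of fun v i => if v = G.tail i then 1 else if v = G.head i then -1 else 0

/-- The weighted Laplacian `A W Aᵀ`. -/
def laplacian [Fintype E] [DecidableEq V] [DecidableEq E] (G : DiMultigraph V E)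
    (w : E → ℝ) : Matrix V V ℝ :=
  G.incidence * Matrix.diagonal w * G.incidenceᵀ

/-- The flow `f` obeys, with some phase angles `φ`, Kirchhoff's law `A f = p` and Ohm's law
`f = W Aᵀ φ`. -/
def IsPowerFlow [Fintype V] [Fintype E] [DecidableEq V] [DecidableEq E]
    (G : DiMultigraph V E) (w : E → ℝ) (p : V → ℝ) (f : E → ℝ) : Prop :=
  G.incidence *ᵥ f = p ∧
    ∃ φ : V → ℝ, f = Matrix.diagonal w *ᵥ (G.incidenceᵀ *ᵥ φ)

/-- The supply-demand vector `p` can be served with weights `w`: the DC power flow equations have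
a solution. This is automatic for balanced `p` when the graph is connected and all weights are
positive; it can fail when weights are zero, i.e. when links are disconnected. -/
def PowerFlowSolvable [Fintype V] [Fintype E] [DecidableEq V] [DecidableEq E]
    (G : DiMultigraph V E) (w : E → ℝ) (p : V → ℝ) : Prop :=
  ∃ f, G.IsPowerFlow w p f

/-- The flow `f(w, p) = W Aᵀ L† p`. -/
noncomputable def powerFlow [Fintype V] [Fintype E] [DecidableEq V] [DecidableEq E]
    (G : DiMultigraph V E) (w : E → ℝ) (p : V → ℝ) : E → ℝ :=
  Matrix.diagonal w *ᵥ (G.incidenceᵀ *ᵥ (moorePenrose (G.laplacian w) *ᵥ p))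

/-- The kernel of the Laplacian consists of phase angles without flow. -/
theorem flow_eq_zero_of_laplacian [Fintype V] [Fintype E] [DecidableEq V] [DecidableEq E]
    {G : DiMultigraph V E} {w : E → ℝ} (hw : 0 ≤ w) {x : V → ℝ}
    (hLx : G.laplacian w *ᵥ x = 0) : Matrix.diagonal w *ᵥ (G.incidenceᵀ *ᵥ x) = 0 := by
  set y : E → ℝ := G.incidenceᵀ *ᵥ x with hy
  have hq : ∑ i, y i * (w i * y i) = 0 := by
    have h1 : x ⬝ᵥ (G.laplacian w *ᵥ x) = 0 := by rw [hLx, dotProduct_zero]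
    have h2 : x ⬝ᵥ (G.laplacian w *ᵥ x) = y ⬝ᵥ (Matrix.diagonal w *ᵥ y) := by
      rw [laplacian, ← Matrix.mulVec_mulVec, ← Matrix.mulVec_mulVec, ← hy,
        Matrix.dotProduct_mulVec, ← Matrix.mulVec_transpose, ← hy]
    rw [h1] at h2
    simpa [dotProduct, Matrix.mulVec_diagonal] using h2.symm
  funext i
  have hnn : ∀ j ∈ Finset.univ, 0 ≤ y j * (w j * y j) := fun j _ => by
    nlinarith [mul_nonneg (hw j) (mul_self_nonneg (y j))]
  have hi := (Finset.sum_eq_zero_iff_of_nonneg hnn).mp hq i (Finset.mem_univ i)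
  rw [Matrix.mulVec_diagonal]
  rcases mul_eq_zero.mp hi with h0 | h0
  · simp [h0]
  · simpa using h0

/-- For nonnegative weights, `powerFlow` is the only possible solution of the DC power flow
equations. -/
theorem IsPowerFlow.eq_powerFlow [Fintype V] [Fintype E] [DecidableEq V] [DecidableEq E]
    {G : DiMultigraph V E} {w : E → ℝ} (hw : 0 ≤ w) {p : V → ℝ} {f : E → ℝ}
    (h : G.IsPowerFlow w p f) : f = G.powerFlow w p := by
  obtain ⟨hA, φ, hf⟩ := h
  have hL : G.laplacian w *ᵥ φ = p := by
    rw [← hA, hf, laplacian, Matrix.mulVec_mulVec, Matrix.mulVec_mulVec, Matrix.mul_assoc]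
  have hP : G.laplacian w * moorePenrose (G.laplacian w) * G.laplacian w = G.laplacian w :=
    (exists_isMoorePenrose (G.laplacian w)).choose_spec.1
  set x : V → ℝ := moorePenrose (G.laplacian w) *ᵥ p - φ with hx
  have hLx : G.laplacian w *ᵥ x = 0 := by
    have e : G.laplacian w *ᵥ (moorePenrose (G.laplacian w) *ᵥ (G.laplacian w *ᵥ φ))
        = G.laplacian w *ᵥ φ := by
      rw [Matrix.mulVec_mulVec, Matrix.mulVec_mulVec, hP]
    rw [hx, Matrix.mulVec_sub, ← hL, e, sub_self]
  have hz := flow_eq_zero_of_laplacian hw hLx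
  rw [hf, powerFlow]
  rw [hx, Matrix.mulVec_sub, Matrix.mulVec_sub, sub_eq_zero] at hz
  exact hz.symm

/-- With positive weights on a connected graph, the DC power flow equations are solvable for every
balanced supply-demand vector. -/
theorem powerFlowSolvable_of_pos [Fintype V] [Fintype E] [DecidableEq V] [DecidableEq E]
    {G : DiMultigraph V E} (hG : G.WeaklyConnected) {w : E → ℝ} (hw : ∀ i, 0 < w i)
    {p : V → ℝ} (hp : ∑ v, p v = 0) : G.PowerFlowSolvable w p := by
  set L := G.laplacian w with hLdef
  set X := moorePenrose L with hX
  obtain ⟨h1, -, h3, -⟩ : IsMoorePenrose L X := (exists_isMoorePenrose L).choose_spec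
  have hLt : Lᵀ = L := by
    simp [hLdef, laplacian, Matrix.transpose_mul, Matrix.mul_assoc]
  have hLLX : L * (L * X) = L := by
    have h := congrArg Matrix.transpose h1
    rw [Matrix.transpose_mul, h3, hLt] at h
    exact h
  set r : V → ℝ := p - L *ᵥ (X *ᵥ p) with hr
  have hLr : L *ᵥ r = 0 := by
    rw [hr, Matrix.mulVec_sub, Matrix.mulVec_mulVec, Matrix.mulVec_mulVec, Matrix.mul_assoc, hLLX,
      sub_self]
  have hz := flow_eq_zero_of_laplacian (fun i => (hw i).le) hLr
  have hAt : ∀ (x : V → ℝ) (i : E), (G.incidenceᵀ *ᵥ x) i = x (G.tail i) - x (G.head i) := by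
    intro x i
    have hne := G.tail_ne_head i
    have e : ∀ v, G.incidence v i * x v =
        (if v = G.tail i then x v else 0) - (if v = G.head i then x v else 0) := by
      intro v
      simp only [incidence, Matrix.of_apply]
      split_ifs with a b <;> simp_all
    simp only [Matrix.mulVec, dotProduct, Matrix.transpose_apply, e, Finset.sum_sub_distrib,
      Finset.sum_ite_eq', Finset.mem_univ, if_true]
  have hedge : ∀ i, r (G.tail i) = r (G.head i) := by
    intro i
    have h := congrFun hz i
    rw [Matrix.mulVec_diagonal, hAt] at h
    rcases mul_eq_zero.mp h with h0 | h0
    · exact absurd h0 (hw i).ne'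
    · exact sub_eq_zero.mp h0
  have hadj : ∀ u v, G.underlying.Adj u v → r u = r v := by
    rintro u v ⟨i, ⟨rfl, rfl⟩ | ⟨rfl, rfl⟩⟩
    · exact hedge i
    · exact (hedge i).symm
  have hconst : ∀ u v, r u = r v := by
    intro u v
    obtain ⟨q⟩ := hG.preconnected u v
    induction q with
    | nil => rfl
    | cons h _ ih => exact (hadj _ _ h).trans ih
  have hsumL : ∀ x : V → ℝ, ∑ v, (L *ᵥ x) v = 0 := by
    intro x
    have : (fun _ : V => (1 : ℝ)) ⬝ᵥ (L *ᵥ x) = 0 := by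
      rw [Matrix.dotProduct_mulVec, ← Matrix.mulVec_transpose, hLt, hLdef, laplacian,
        ← Matrix.mulVec_mulVec]
      have : G.incidenceᵀ *ᵥ (fun _ : V => (1 : ℝ)) = 0 := by
        funext i; rw [hAt]; simp
      rw [this]; simp
    simpa [dotProduct] using this
  have hrs : ∑ v, r v = 0 := by
    simp only [hr, Pi.sub_apply, Finset.sum_sub_distrib, hp, hsumL, sub_self]
  have hr0 : r = 0 := by
    funext v
    have hs : ∑ u, r u = Fintype.card V • r v := by
      rw [Finset.sum_congr rfl (fun u _ => hconst u v)]; simp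
    rw [hrs] at hs
    have : Nonempty V := ⟨v⟩
    simpa using hs.symm
  refine ⟨Matrix.diagonal w *ᵥ (G.incidenceᵀ *ᵥ (X *ᵥ p)), ?_, X *ᵥ p, rfl⟩
  have : L *ᵥ (X *ᵥ p) = p := (sub_eq_zero.mp hr0).symm
  rw [hLdef, laplacian, ← Matrix.mulVec_mulVec, ← Matrix.mulVec_mulVec] at this
  exact this

/-- Weights `w` within `[wl, wu]` serve `p` with all link flows within `[cl, cu]`. -/
def Feasible [Fintype V] [Fintype E] [DecidableEq V] [DecidableEq E]
    (G : DiMultigraph V E) (wl wu cl cu : E → ℝ) (p : V → ℝ) (w : E → ℝ) : Prop :=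
  0 ≤ w ∧ wl ≤ w ∧ w ≤ wu ∧ G.PowerFlowSolvable w p ∧
    cl ≤ G.powerFlow w p ∧ G.powerFlow w p ≤ cu

/-- `ν(δ)`: the largest magnitude `μ ≥ 0` of a disturbance in direction `δ` under which some
admissible weights are feasible (as a supremum of extended reals). -/
noncomputable def directionalMargin [Fintype V] [Fintype E] [DecidableEq V] [DecidableEq E]
    (G : DiMultigraph V E) (wl wu cl cu : E → ℝ) (p₀ : V → ℝ) (δ : V → ℝ) : EReal :=
  sSup {x : EReal | ∃ μ : ℝ, x = (μ : EReal) ∧ 0 ≤ μ ∧ ∃ w, G.Feasible wl wu cl cu (p₀ + μ • δ) w}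

/-- `ν*`: the centralized margin of robustness, the minimum (infimum) of `ν(δ)` over the balanced
directions `δ` of unit `ℓ₁` norm. -/
noncomputable def margin [Fintype V] [Fintype E] [DecidableEq V] [DecidableEq E]
    (G : DiMultigraph V E) (wl wu cl cu : E → ℝ) (p₀ : V → ℝ) : EReal :=
  sInf {x : EReal | ∃ δ : V → ℝ, ∑ v, |δ v| = 1 ∧ ∑ v, δ v = 0 ∧
    x = G.directionalMargin wl wu cl cu p₀ δ}

/-- The graph of the associated flow network: all links (`Sum.inl i`) together with their reversed
versions (`Sum.inr i`). -/
def flowGraph (G : DiMultigraph V E) : DiMultigraph V (E ⊕ E) where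
  tail := Sum.elim G.tail G.head
  head := Sum.elim G.head G.tail
  tail_ne_head := by
    rintro (i | i)
    · exact G.tail_ne_head i
    · exact (G.tail_ne_head i).symm

/-- The capacities of the associated flow network for the initial flow `f₀`. -/
def flowCapacity (cl cu f₀ : E → ℝ) : E ⊕ E → ℝ :=
  Sum.elim (fun i => cu i - f₀ i) (fun i => -cl i + f₀ i)

/-- The capacity of the cut from `S` to its complement. -/
def cutCapacity [Fintype E] [DecidableEq V] (G : DiMultigraph V E) (c : E → ℝ)
    (S : Finset V) : ℝ :=
  ∑ i with G.tail i ∈ S ∧ G.head i ∉ S, c i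

/-- The min-cut capacity: the minimum of the cut capacities over the finitely many nonempty proper
subsets of the nodes. -/
noncomputable def minCut [Fintype V] [Fintype E] [DecidableEq V] (G : DiMultigraph V E)
    (c : E → ℝ) : ℝ :=
  ⨅ S : {S : Finset V // S.Nonempty ∧ S ≠ Finset.univ}, G.cutCapacity c S

end DiMultigraph

/-! A balanced disturbance of unit ℓ₁ norm moves at most half a unit of power out of any node set,
hence the factor 2. For the upper bound, put +1/2 and -1/2 on the two sides of a minimum cut:
serving magnitude μ sends μ/2 more than `f₀` across the cut, and this cannot exceed the residual
capacity there (`margin_le_two_mul_minCut`).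

For the converse, max-flow min-cut with several terminals (`exists_flow_of_le_cutCapacity`) meets
the demand at μ = 2C, where C is the min-cut capacity, by a flow in the box `[cl, cu]` that need not
obey Ohm's law. It remains to realize the demand of such a flow with admissible weights. On a tree,
Kirchhoff's law alone determines the flow, so any positive weights produce it. If `wl = 0`,
circulations are cancelled first (`exists_acyclic_flow`); an acyclic flow runs downhill for some
potential, and Ohm's law then defines the weights, zero on links without flow
(`exists_weights_of_acyclic`). -/

namespace DiMultigraph

variable {V E : Type*} [Fintype V] [Fintype E] [DecidableEq V] [DecidableEq E]
  (G : DiMultigraph V E)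

/-! ### Incidence matrix, net outflow and cut capacities -/

omit [Fintype V] [Fintype E] [DecidableEq E] in
theorem incidence_apply (v : V) (i : E) :
    G.incidence v i = (if v = G.tail i then 1 else 0) - (if v = G.head i then 1 else 0) := by
  have hne := G.tail_ne_head i
  simp only [incidence, Matrix.of_apply]
  split_ifs <;> simp_all

omit [Fintype E] [DecidableEq E] in
theorem incidence_transpose_mulVec (x : V → ℝ) (i : E) :
    (G.incidenceᵀ *ᵥ x) i = x (G.tail i) - x (G.head i) := by
  simp [Matrix.mulVec, dotProduct, incidence_apply, sub_mul, Finset.sum_sub_distrib]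

omit [Fintype V] in
theorem incidence_mulVec_single (i : E) (a : ℝ) :
    G.incidence *ᵥ Pi.single i a = Pi.single (G.tail i) a - Pi.single (G.head i) a := by
  funext v
  simp [Matrix.mulVec, dotProduct, incidence_apply, Pi.single_apply, sub_mul]

omit [Fintype V] [DecidableEq E] in
/-- The net outflow of a node set. -/
theorem sum_incidence_mulVec (g : E → ℝ) (S : Finset V) :
    ∑ v ∈ S, (G.incidence *ᵥ g) v =
      ∑ i, ((if G.tail i ∈ S then g i else 0) - (if G.head i ∈ S then g i else 0)) := by
  simp only [Matrix.mulVec, dotProduct]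
  rw [Finset.sum_comm]
  refine Finset.sum_congr rfl fun i _ => ?_
  simp [incidence_apply, sub_mul, Finset.sum_sub_distrib]

theorem sum_univ_incidence_mulVec (g : E → ℝ) : ∑ v, (G.incidence *ᵥ g) v = 0 := by
  rw [sum_incidence_mulVec]; simp

omit [Fintype V] [DecidableEq E] in
theorem cutCapacity_flowGraph (cl cu f₀ : E → ℝ) (S : Finset V) :
    G.flowGraph.cutCapacity (flowCapacity cl cu f₀) S =
      ∑ i, ((if G.tail i ∈ S ∧ G.head i ∉ S then cu i - f₀ i else 0) +
        (if G.head i ∈ S ∧ G.tail i ∉ S then f₀ i - cl i else 0)) := by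
  rw [cutCapacity, Finset.sum_filter, Fintype.sum_sum_type, ← Finset.sum_add_distrib]
  refine Finset.sum_congr rfl fun i _ => ?_
  simp [flowGraph, flowCapacity, sub_eq_neg_add]

/-- Weak duality: links inside `S` cancel, and each crossing link can gain no more than its residual
capacity. -/
theorem sum_incidence_mulVec_sub_le_cutCapacity {cl cu f f₀ : E → ℝ} (hl : cl ≤ f) (hu : f ≤ cu)
    (S : Finset V) :
    ∑ v ∈ S, (G.incidence *ᵥ (f - f₀)) v ≤
      G.flowGraph.cutCapacity (flowCapacity cl cu f₀) S := by
  rw [cutCapacity_flowGraph, sum_incidence_mulVec]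
  refine Finset.sum_le_sum fun i _ => ?_
  have := hl i
  have := hu i
  by_cases h1 : G.tail i ∈ S <;> by_cases h2 : G.head i ∈ S <;> simp [h1, h2] <;> linarith

/-! ### Max-flow min-cut through least squares -/

/-- First-order optimality of a least-squares fit of `d` by flows within a box. -/
theorem exists_leastSquares_flow {l u : E → ℝ} (hlu : l ≤ u) (d : V → ℝ) :
    ∃ g, l ≤ g ∧ g ≤ u ∧ ∀ r : V → ℝ, r = d - G.incidence *ᵥ g → ∀ i,
      (r (G.head i) < r (G.tail i) → g i = u i) ∧
      (r (G.tail i) < r (G.head i) → g i = l i) := by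
  have hcont : Continuous fun g : E → ℝ => ∑ v, (d v - (G.incidence *ᵥ g) v) ^ 2 := by
    simp only [Matrix.mulVec, dotProduct]; fun_prop
  obtain ⟨g, ⟨hl, hu⟩, hmin⟩ :=
    (isCompact_Icc (a := l) (b := u)).exists_isMinOn ⟨l, le_rfl, hlu⟩ hcont.continuousOn
  refine ⟨g, hl, hu, ?_⟩
  rintro r hr i
  -- Adding `t` on link `i` changes the squared error by `2 * t * (t - D)`, with `D` the residual at
  -- the tail minus that at the head.
  have key : ∀ t : ℝ, l i ≤ g i + t → g i + t ≤ u i →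
      0 ≤ t * (t - (r (G.tail i) - r (G.head i))) := by
    intro t h1 h2
    have hmem : g + Pi.single i t ∈ Set.Icc l u := by
      constructor <;> intro j <;> rcases eq_or_ne j i with rfl | hj
      · simpa using h1
      · simpa [hj] using hl j
      · simpa using h2
      · simpa [hj] using hu j
    have h := isMinOn_iff.mp hmin _ hmem
    simp only [Matrix.mulVec_add, incidence_mulVec_single] at h
    have e : ∀ v, (d v - (G.incidence *ᵥ g + (Pi.single (G.tail i) t - Pi.single (G.head i) t) : V → ℝ) v) ^ 2
        = (d v - (G.incidence *ᵥ g) v) ^ 2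
          + (if v = G.tail i then t * (t - 2 * r v) else 0)
          + (if v = G.head i then t * (t + 2 * r v) else 0) := by
      intro v
      have hne := G.tail_ne_head i
      simp only [hr, Pi.add_apply, Pi.sub_apply, Pi.single_apply]
      split_ifs with a b
      · exact absurd (a.symm.trans b) hne
      all_goals ring
    simp only [e, Finset.sum_add_distrib, Finset.sum_ite_eq', Finset.mem_univ, if_true] at h
    nlinarith
  constructor
  · intro hlt
    by_contra hne
    have hgu : g i < u i := lt_of_le_of_ne (hu i) hne
    set D := r (G.tail i) - r (G.head i)
    have hD : 0 < D := sub_pos.mpr hlt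
    -- The bound `D / 2` keeps `t - D` negative; the bound `u i - g i` keeps the flow in the box.
    have ht : 0 < min (D / 2) (u i - g i) := lt_min (by linarith) (by linarith)
    have h1 := min_le_left (D / 2) (u i - g i)
    have h2 := min_le_right (D / 2) (u i - g i)
    have := key _ (by linarith [hl i]) (by linarith)
    nlinarith
  · intro hlt
    by_contra hne
    have hgl : l i < g i := lt_of_le_of_ne (hl i) (Ne.symm hne)
    set D := r (G.tail i) - r (G.head i)
    have hD : D < 0 := sub_neg.mpr hlt
    have ht : 0 < min (-D / 2) (g i - l i) := lt_min (by linarith) (by linarith)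
    have h1 := min_le_left (-D / 2) (g i - l i)
    have h2 := min_le_right (-D / 2) (g i - l i)
    have := key (-min (-D / 2) (g i - l i)) (by linarith) (by linarith [hu i])
    nlinarith

/-- The max-flow min-cut theorem for several sources and sinks: a balanced demand that respects
every cut is met by a flow within the capacities. -/
theorem exists_flow_of_le_cutCapacity {cl cu f₀ : E → ℝ} (hl : cl ≤ f₀) (hu : f₀ ≤ cu)
    {d : V → ℝ} (hd : ∑ v, d v = 0)
    (hcut : ∀ S : Finset V, S.Nonempty → S ≠ Finset.univ →
      ∑ v ∈ S, d v ≤ G.flowGraph.cutCapacity (flowCapacity cl cu f₀) S) :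
    ∃ f, cl ≤ f ∧ f ≤ cu ∧ G.incidence *ᵥ f = G.incidence *ᵥ f₀ + d := by
  obtain ⟨f, hfl, hfu, hopt⟩ :=
    G.exists_leastSquares_flow (hl.trans hu) (G.incidence *ᵥ f₀ + d)
  set r := G.incidence *ᵥ f₀ + d - G.incidence *ᵥ f with hr
  replace hopt := hopt r rfl
  refine ⟨f, hfl, hfu, ?_⟩
  have hrsum : ∑ v, r v = 0 := by
    simp [hr, Finset.sum_add_distrib, sum_univ_incidence_mulVec, hd]
  by_contra hne
  have hr0 : r ≠ 0 := fun h => hne (sub_eq_zero.mp h).symm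
  obtain ⟨v₀, hv₀⟩ := Function.ne_iff.mp hr0
  obtain ⟨a, -, ha⟩ := Finset.exists_pos_of_sum_zero_of_exists_nonzero r hrsum
    ⟨v₀, Finset.mem_univ _, hv₀⟩
  obtain ⟨b, -, hb⟩ := Finset.exists_pos_of_sum_zero_of_exists_nonzero (-r)
    (by simpa using hrsum) ⟨v₀, Finset.mem_univ _, by simpa using hv₀⟩
  -- Optimality saturates every link across the boundary of `S`, so the outflow of `S` already
  -- exceeds that of `f₀` by the whole cut capacity. A positive residual on `S` would then demand
  -- more than `hcut` allows.
  set S : Finset V := Finset.univ.filter fun v => 0 < r v with hS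
  have hmem : ∀ v, v ∈ S ↔ 0 < r v := by simp [hS]
  have haS : a ∈ S := (hmem a).mpr ha
  have hbS : b ∉ S := by
    rw [hmem]; simp only [Pi.neg_apply] at hb; linarith
  have hc := hcut S ⟨a, haS⟩ fun h => hbS (h ▸ Finset.mem_univ b)
  have hflow : ∑ v ∈ S, (G.incidence *ᵥ (f - f₀)) v =
      G.flowGraph.cutCapacity (flowCapacity cl cu f₀) S := by
    rw [cutCapacity_flowGraph, sum_incidence_mulVec]
    refine Finset.sum_congr rfl fun i _ => ?_
    obtain ⟨o1, o2⟩ := hopt i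
    by_cases h1 : G.tail i ∈ S <;> by_cases h2 : G.head i ∈ S
    · simp [h1, h2]
    · rw [hmem] at h1 h2
      simp [hmem, h1, h2, o1 (by linarith)]
    · rw [hmem] at h1 h2
      simp [hmem, h1, h2, o2 (by linarith)]
    · simp [h1, h2]
  have hrS : 0 < ∑ v ∈ S, r v :=
    Finset.sum_pos (fun v hv => (hmem v).mp hv) ⟨a, haS⟩
  have : ∑ v ∈ S, r v = ∑ v ∈ S, d v - ∑ v ∈ S, (G.incidence *ᵥ (f - f₀)) v := by
    rw [← Finset.sum_sub_distrib]
    refine Finset.sum_congr rfl fun v _ => ?_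
    simp only [hr, Matrix.mulVec_sub, Pi.sub_apply, Pi.add_apply]; ring
  linarith

/-! ### Cancelling circulations; potentials of acyclic flows -/

/-- `v` follows `u` in the direction of the flow `f`. -/
def FlowStep (f : E → ℝ) (u v : V) : Prop :=
  ∃ i, (0 < f i ∧ G.tail i = u ∧ G.head i = v) ∨ (f i < 0 ∧ G.head i = u ∧ G.tail i = v)

/-- A path along the flow carries a flow that is conformal to it. -/
theorem exists_conformal_of_transGen {f : E → ℝ} {u v : V}
    (h : Relation.TransGen (G.FlowStep f) u v) :
    ∃ t : E → ℝ, 0 ≤ t ∧ (∃ i, 0 < t i ∧ f i ≠ 0) ∧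
      G.incidence *ᵥ (t * f) = Pi.single u 1 - Pi.single v 1 := by
  have step : ∀ {u v}, G.FlowStep f u v → ∃ t : E → ℝ, 0 ≤ t ∧ (∃ i, 0 < t i ∧ f i ≠ 0) ∧
      G.incidence *ᵥ (t * f) = Pi.single u 1 - Pi.single v 1 := by
    rintro u v ⟨i, ⟨hf, rfl, rfl⟩ | ⟨hf, rfl, rfl⟩⟩
    · refine ⟨Pi.single i (f i)⁻¹, Pi.single_nonneg.mpr (inv_pos.mpr hf).le,
        ⟨i, by simpa using hf, hf.ne'⟩, ?_⟩
      have e : Pi.single i (f i)⁻¹ * f = Pi.single i 1 := by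
        funext j
        rcases eq_or_ne j i with rfl | hj
        · simp [hf.ne']
        · simp [hj]
      rw [e, incidence_mulVec_single]
    · refine ⟨Pi.single i (-f i)⁻¹, Pi.single_nonneg.mpr (inv_pos.mpr (neg_pos.mpr hf)).le,
        ⟨i, by rw [Pi.single_eq_same]; exact inv_pos.mpr (neg_pos.mpr hf), hf.ne⟩, ?_⟩
      have e : Pi.single i (-f i)⁻¹ * f = Pi.single i (-1) := by
        funext j
        rcases eq_or_ne j i with rfl | hj
        · simp [hf.ne, inv_neg]
        · simp [hj]
      rw [e, incidence_mulVec_single, Pi.single_neg, Pi.single_neg]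
      abel
  induction h with
  | single h => exact step h
  | tail _ h ih =>
    obtain ⟨t, ht, ⟨i, hi, hfi⟩, he⟩ := ih
    obtain ⟨s, hs, -, hse⟩ := step h
    refine ⟨t + s, add_nonneg ht hs, ⟨i, add_pos_of_pos_of_nonneg hi (hs i), hfi⟩, ?_⟩
    rw [add_mul, Matrix.mulVec_add, he, hse]
    abel

/-- Circulations can be cancelled from a flow within capacities. -/
theorem exists_acyclic_flow {cl cu f : E → ℝ} (hcl : ∀ i, cl i < 0) (hcu : ∀ i, 0 < cu i)
    (hl : cl ≤ f) (hu : f ≤ cu) :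
    ∃ g, cl ≤ g ∧ g ≤ cu ∧ G.incidence *ᵥ g = G.incidence *ᵥ f ∧
      ∀ v, ¬ Relation.TransGen (G.FlowStep g) v v := by
  have hcont : Continuous fun g : E → ℝ => G.incidence *ᵥ g := by fun_prop
  have hK : IsCompact (Set.Icc cl cu ∩ {g | G.incidence *ᵥ g = G.incidence *ᵥ f}) :=
    isCompact_Icc.inter_right (isClosed_eq hcont continuous_const)
  -- The flow of least energy among those with the same net outflows has no directed cycle:
  -- subtracting part of a cycle would lower the energy.
  obtain ⟨g, ⟨⟨hgl, hgu⟩, hg⟩, hmin⟩ :=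
    hK.exists_isMinOn ⟨f, ⟨hl, hu⟩, rfl⟩
      (f := fun g : E → ℝ => ∑ i, g i ^ 2) (by fun_prop)
  refine ⟨g, hgl, hgu, hg, fun v hv => ?_⟩
  obtain ⟨t, ht, ⟨i, hi, hgi⟩, he⟩ := G.exists_conformal_of_transGen hv
  rw [sub_self] at he
  have hT : ∀ j, t j ≤ ∑ k, t k := fun j =>
    Finset.single_le_sum (fun k _ => ht k) (Finset.mem_univ j)
  have hT0 : 0 < ∑ k, t k := hi.trans_le (hT i)
  -- With this ε every factor `1 - ε * t j` lies in `[0, 1]`, so each link flow shrinks towards 0,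
  -- which lies in the box.
  set ε := (∑ k, t k)⁻¹ with hε
  have hε0 : 0 < ε := inv_pos.mpr hT0
  have hεt : ∀ j, 0 ≤ ε * t j ∧ ε * t j ≤ 1 := fun j =>
    ⟨mul_nonneg hε0.le (ht j), by
      rw [hε, inv_mul_le_iff₀ hT0, mul_one]; exact hT j⟩
  have hval : ∀ j, (g - ε • (t * g)) j = (1 - ε * t j) * g j := fun j => by
    simp only [Pi.sub_apply, Pi.smul_apply, Pi.mul_apply, smul_eq_mul]; ring
  have hmem : g - ε • (t * g) ∈
      Set.Icc cl cu ∩ {g | G.incidence *ᵥ g = G.incidence *ᵥ f} := by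
    refine ⟨⟨fun j => ?_, fun j => ?_⟩, ?_⟩
    · rw [hval]
      nlinarith [hεt j, hgl j, hcl j, mul_nonneg (sub_nonneg.mpr (hεt j).2)
        (sub_nonneg.mpr (hgl j)), mul_nonneg (hεt j).1 (neg_nonneg.mpr (hcl j).le)]
    · rw [hval]
      nlinarith [hεt j, hgu j, hcu j, mul_nonneg (sub_nonneg.mpr (hεt j).2)
        (sub_nonneg.mpr (hgu j)), mul_nonneg (hεt j).1 (hcu j).le]
    · change G.incidence *ᵥ (g - ε • (t * g)) = G.incidence *ᵥ f
      rw [Matrix.mulVec_sub, Matrix.mulVec_smul, he, smul_zero, sub_zero]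
      exact hg
  have h := isMinOn_iff.mp hmin _ hmem
  simp only [hval] at h
  refine absurd h (not_le.mpr (Finset.sum_lt_sum (fun j _ => ?_) ⟨i, Finset.mem_univ i, ?_⟩))
  · rw [mul_pow]
    exact mul_le_of_le_one_left (sq_nonneg _)
      (pow_le_one₀ (by linarith [hεt j]) (by linarith [hεt j]))
  · rw [mul_pow]
    have h1 : 0 < ε * t i := mul_pos hε0 hi
    refine mul_lt_of_lt_one_left (by positivity) ?_
    exact pow_lt_one₀ (by linarith [(hεt i).2]) (by linarith) two_ne_zero

/-- A flow without directed cycles is driven by phase angles, under arbitrarily small weights. -/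
theorem exists_weights_of_acyclic {wu f : E → ℝ} (hwu : ∀ i, 0 < wu i)
    (hf : ∀ v, ¬ Relation.TransGen (G.FlowStep f) v v) :
    ∃ w, 0 ≤ w ∧ w ≤ wu ∧ ∃ φ : V → ℝ, f = Matrix.diagonal w *ᵥ (G.incidenceᵀ *ᵥ φ) := by
  classical
  -- The potential counts the nodes strictly downstream. It drops by at least 1 along a step from
  -- `u` to `v`, since `v` is downstream of `u` but, by acyclicity, not of itself.
  set ψ : V → ℝ := fun v =>
    ((Finset.univ.filter fun u => Relation.TransGen (G.FlowStep f) v u).card : ℝ) with hψ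
  have hstep : ∀ u v, G.FlowStep f u v → ψ v + 1 ≤ ψ u := by
    intro u v h
    have hlt : (Finset.univ.filter fun x => Relation.TransGen (G.FlowStep f) v x).card <
        (Finset.univ.filter fun x => Relation.TransGen (G.FlowStep f) u x).card := by
      refine Finset.card_lt_card ⟨fun x hx => ?_, fun hsub => ?_⟩
      · simp only [Finset.mem_filter, Finset.mem_univ, true_and] at hx ⊢
        exact Relation.TransGen.head h hx
      · have := @hsub v (by simpa using Relation.TransGen.single h)
        exact hf v (by simpa using this)
    simp only [hψ]
    exact_mod_cast hlt
  -- Scaling the potential by `K` makes the weights required by Ohm's law small enough for `wu`, as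
  -- potential drops along the flow are at least `K`.
  set K := ∑ i, |f i| / wu i with hK
  have hKi : ∀ i, |f i| / wu i ≤ K := fun i =>
    Finset.single_le_sum (f := fun i => |f i| / wu i)
      (fun k _ => div_nonneg (abs_nonneg _) (hwu k).le) (Finset.mem_univ i)
  have key : ∀ i, ∃ x, 0 ≤ x ∧ x ≤ wu i ∧
      f i = x * (K * ψ (G.tail i) - K * ψ (G.head i)) := by
    intro i
    rcases eq_or_ne (f i) 0 with h0 | h0
    · exact ⟨0, le_rfl, (hwu i).le, by simp [h0]⟩
    have hfw : 0 < |f i| / wu i := div_pos (abs_pos.mpr h0) (hwu i)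
    have hK0 : 0 < K := hfw.trans_le (hKi i)
    have hfK : |f i| ≤ K * wu i := (div_le_iff₀ (hwu i)).mp (hKi i)
    have main : ∀ D : ℝ, 1 ≤ D →
        0 ≤ |f i| / (K * D) ∧ |f i| / (K * D) ≤ wu i := fun D hD => by
      have hD0 : 0 < D := by linarith
      refine ⟨by positivity, (div_le_iff₀ (by positivity)).mpr (hfK.trans ?_)⟩
      nlinarith [mul_pos hK0 (hwu i)]
    rcases lt_or_gt_of_ne h0 with hn | hp
    · have hD := hstep _ _ ⟨i, Or.inr ⟨hn, rfl, rfl⟩⟩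
      have hD1 : 1 ≤ ψ (G.head i) - ψ (G.tail i) := by linarith
      have hD0 : ψ (G.head i) - ψ (G.tail i) ≠ 0 := by linarith
      obtain ⟨m1, m2⟩ := main _ hD1
      refine ⟨_, m1, m2, ?_⟩
      rw [abs_of_neg hn]; field_simp; ring
    · have hD := hstep _ _ ⟨i, Or.inl ⟨hp, rfl, rfl⟩⟩
      have hD1 : 1 ≤ ψ (G.tail i) - ψ (G.head i) := by linarith
      have hD0 : ψ (G.tail i) - ψ (G.head i) ≠ 0 := by linarith
      obtain ⟨m1, m2⟩ := main _ hD1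
      refine ⟨_, m1, m2, ?_⟩
      rw [abs_of_pos hp]; field_simp
  choose w hw0 hwu' hw using key
  refine ⟨w, hw0, hwu', fun v => K * ψ v, ?_⟩
  funext i
  rw [Matrix.mulVec_diagonal, incidence_transpose_mulVec]
  exact hw i

/-! ### Feasibility from a power flow; attained minimum cuts -/

theorem PowerFlowSolvable.isPowerFlow {G : DiMultigraph V E} {w : E → ℝ} {p : V → ℝ}
    (hw : 0 ≤ w) (h : G.PowerFlowSolvable w p) : G.IsPowerFlow w p (G.powerFlow w p) := by
  obtain ⟨f, hf⟩ := h
  exact hf.eq_powerFlow hw ▸ hf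

theorem IsPowerFlow.feasible {G : DiMultigraph V E} {wl wu cl cu w f : E → ℝ} {p : V → ℝ}
    (h : G.IsPowerFlow w p f) (hw : 0 ≤ w) (hl : wl ≤ w) (hu : w ≤ wu) (hfl : cl ≤ f)
    (hfu : f ≤ cu) : G.Feasible wl wu cl cu p w := by
  have e := h.eq_powerFlow hw
  exact ⟨hw, hl, hu, ⟨f, h⟩, e ▸ hfl, e ▸ hfu⟩

omit [DecidableEq E] in
theorem minCut_le_cutCapacity (c : E → ℝ) {S : Finset V} (h1 : S.Nonempty)
    (h2 : S ≠ Finset.univ) : G.minCut c ≤ G.cutCapacity c S :=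
  ciInf_le (Set.finite_range fun S : {S : Finset V // S.Nonempty ∧ S ≠ Finset.univ} =>
    G.cutCapacity c S).bddBelow ⟨S, h1, h2⟩

instance nonempty_cuts [Nontrivial V] :
    Nonempty {S : Finset V // S.Nonempty ∧ S ≠ Finset.univ} := by
  obtain ⟨u, v, huv⟩ := exists_pair_ne V
  refine ⟨{u}, Finset.singleton_nonempty u, fun h => huv ?_⟩
  have := Finset.mem_univ v
  rw [← h, Finset.mem_singleton] at this
  exact this.symm

omit [DecidableEq E] in
theorem exists_cutCapacity_eq_minCut [Nontrivial V] (c : E → ℝ) :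
    ∃ S : Finset V, S.Nonempty ∧ S ≠ Finset.univ ∧ G.cutCapacity c S = G.minCut c := by
  obtain ⟨⟨S, h1, h2⟩, h⟩ := exists_eq_ciInf_of_finite
    (f := fun S : {S : Finset V // S.Nonempty ∧ S ≠ Finset.univ} => G.cutCapacity c S)
  exact ⟨S, h1, h2, h⟩

omit [DecidableEq E] in
theorem minCut_flowGraph_nonneg [Nontrivial V] {cl cu f₀ : E → ℝ} (hl : cl ≤ f₀) (hu : f₀ ≤ cu) :
    0 ≤ G.flowGraph.minCut (flowCapacity cl cu f₀) := by
  refine le_ciInf fun S => Finset.sum_nonneg ?_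
  rintro (i | i) _
  · exact sub_nonneg.mpr (hu i)
  · have := hl i
    simp only [flowCapacity, Sum.elim_inr]; linarith

/-! ### Upper and lower bounds on the margin -/

theorem margin_le_two_mul_minCut [Nontrivial V] {wl wu cl cu f₀ : E → ℝ} {p₀ : V → ℝ}
    (hf₀ : G.incidence *ᵥ f₀ = p₀) :
    G.margin wl wu cl cu p₀ ≤
      ((2 * G.flowGraph.minCut (flowCapacity cl cu f₀) : ℝ) : EReal) := by
  obtain ⟨S, ⟨a, ha⟩, hS, hcap⟩ :=
    G.flowGraph.exists_cutCapacity_eq_minCut (flowCapacity cl cu f₀)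
  obtain ⟨b, hb⟩ : ∃ b, b ∉ S := by
    by_contra! h; exact hS (Finset.eq_univ_iff_forall.mpr h)
  have hab : a ≠ b := fun h => hb (h ▸ ha)
  set δ : V → ℝ := Pi.single a (1 / 2) - Pi.single b (1 / 2) with hδ
  have habs : ∀ v, |δ v| = (Pi.single a (1 / 2) + Pi.single b (1 / 2) : V → ℝ) v := by
    intro v
    simp only [hδ, Pi.sub_apply, Pi.add_apply, Pi.single_apply]
    split_ifs with h1 h2
    · exact absurd (h1.symm.trans h2) hab
    all_goals norm_num [abs_of_pos, abs_of_neg]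
  have hδS : ∑ v ∈ S, δ v = 1 / 2 := by
    simp [hδ, Finset.sum_sub_distrib, Finset.sum_pi_single', ha, hb]
  have hmar : G.margin wl wu cl cu p₀ ≤ G.directionalMargin wl wu cl cu p₀ δ := by
    refine sInf_le ⟨δ, ?_, ?_, rfl⟩
    · simp only [habs, Pi.add_apply, Finset.sum_add_distrib, Finset.sum_pi_single']
      norm_num
    · simp [hδ, Finset.sum_sub_distrib, Finset.sum_pi_single']
  refine hmar.trans (sSup_le ?_)
  rintro _ ⟨μ, rfl, -, w, hw0, -, -, hsolv, hl, hu⟩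
  obtain ⟨hA, -⟩ := hsolv.isPowerFlow hw0
  have h := G.sum_incidence_mulVec_sub_le_cutCapacity (f₀ := f₀) hl hu S
  rw [Matrix.mulVec_sub, hA, hf₀, add_sub_cancel_left, hcap] at h
  simp only [Pi.smul_apply, smul_eq_mul, ← Finset.mul_sum, hδS] at h
  exact EReal.coe_le_coe_iff.mpr (by linarith)

/-- The sums over `S` and its complement are opposite, and their absolute values add up to at most
1. -/
theorem sum_le_half_of_sum_eq_zero {δ : V → ℝ} (h1 : ∑ v, |δ v| = 1) (h0 : ∑ v, δ v = 0)
    (S : Finset V) : ∑ v ∈ S, δ v ≤ 1 / 2 := by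
  have e1 := Finset.sum_add_sum_compl S δ
  have e2 := Finset.sum_add_sum_compl S fun v => |δ v|
  have a1 : ∑ v ∈ S, δ v ≤ ∑ v ∈ S, |δ v| := Finset.sum_le_sum fun v _ => le_abs_self _
  have a2 : -∑ v ∈ Sᶜ, δ v ≤ ∑ v ∈ Sᶜ, |δ v| := by
    rw [← Finset.sum_neg_distrib]
    exact Finset.sum_le_sum fun v _ => neg_le_abs _
  linarith

/-- The hypothesis `hfeas` isolates the role of the weights: everything else is max-flow min-cut. -/
theorem two_mul_minCut_le_margin [Nontrivial V] {wl wu cl cu f₀ : E → ℝ} {p₀ : V → ℝ}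
    (hl : cl ≤ f₀) (hu : f₀ ≤ cu) (hf₀ : G.incidence *ᵥ f₀ = p₀)
    (hfeas : ∀ f, cl ≤ f → f ≤ cu → ∃ w, G.Feasible wl wu cl cu (G.incidence *ᵥ f) w) :
    ((2 * G.flowGraph.minCut (flowCapacity cl cu f₀) : ℝ) : EReal) ≤
      G.margin wl wu cl cu p₀ := by
  set C := G.flowGraph.minCut (flowCapacity cl cu f₀) with hC
  have hC0 : 0 ≤ C := G.minCut_flowGraph_nonneg hl hu
  refine le_sInf ?_
  rintro _ ⟨δ, h1, h0, rfl⟩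
  obtain ⟨f, hfl, hfu, hAf⟩ := G.exists_flow_of_le_cutCapacity hl hu
    (d := (2 * C) • δ) (by simp [← Finset.mul_sum, h0]) fun S hS hS' => by
      have hhalf := sum_le_half_of_sum_eq_zero h1 h0 S
      have hle := G.flowGraph.minCut_le_cutCapacity (flowCapacity cl cu f₀) hS hS'
      simp only [Pi.smul_apply, smul_eq_mul, ← Finset.mul_sum]
      nlinarith
  obtain ⟨w, hw⟩ := hfeas f hfl hfu
  rw [hAf, hf₀] at hw
  exact le_sSup ⟨2 * C, rfl, by positivity, w, hw⟩

/-- Only the net outflows of `f` must be kept, so `f` may be replaced by an acyclic flow in the same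
box. -/
theorem exists_feasible_of_zero_le {wu cl cu f : E → ℝ} (hwu : ∀ i, 0 < wu i)
    (hcl : ∀ i, cl i < 0) (hcu : ∀ i, 0 < cu i) (hl : cl ≤ f) (hu : f ≤ cu) :
    ∃ w, G.Feasible 0 wu cl cu (G.incidence *ᵥ f) w := by
  obtain ⟨g, hgl, hgu, hg, hac⟩ := G.exists_acyclic_flow hcl hcu hl hu
  obtain ⟨w, hw0, hwu', hφ⟩ := G.exists_weights_of_acyclic hwu hac
  exact ⟨w, IsPowerFlow.feasible ⟨hg, hφ⟩ hw0 hw0 hwu' hgl hgu⟩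

omit [Fintype E] [DecidableEq E] in
-- Trees: fundamental cuts, unique flows and the min-cut formula
/-- Each link of a tree is the only one that joins some node set and its complement. -/
theorem IsTree.exists_fundamental_cut {G : DiMultigraph V E} (hG : G.IsTree) (i : E) :
    ∃ S : Finset V, G.tail i ∈ S ∧ G.head i ∉ S ∧ ∀ j, j ≠ i → (G.tail j ∈ S ↔ G.head j ∈ S) := by
  classical
  have hadj : G.underlying.Adj (G.tail i) (G.head i) := ⟨i, Or.inl ⟨rfl, rfl⟩⟩
  have hbr := SimpleGraph.isAcyclic_iff_forall_adj_isBridge.mp hG.1.isAcyclic hadj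
  rw [SimpleGraph.isBridge_iff] at hbr
  -- Every tree edge is a bridge; `S` is the component of the tail once it is removed. By
  -- injectivity of endpoints, every link other than `i` survives in `H`.
  set H := G.underlying.deleteEdges {s(G.tail i, G.head i)} with hH
  refine ⟨Finset.univ.filter fun v => H.Reachable (G.tail i) v, ?_, ?_, fun j hj => ?_⟩
  · simp
  · simpa using hbr
  · have hne : s(G.tail j, G.head j) ≠ s(G.tail i, G.head i) := fun h => hj (hG.2 h)
    have hHadj : H.Adj (G.tail j) (G.head j) := by
      rw [hH, SimpleGraph.deleteEdges_adj]
      exact ⟨⟨j, Or.inl ⟨rfl, rfl⟩⟩, hne⟩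
    simp only [Finset.mem_filter, Finset.mem_univ, true_and]
    exact ⟨fun h => h.trans hHadj.reachable, fun h => h.trans hHadj.symm.reachable⟩

/-- The net outflow of a fundamental cut is the flow on its single crossing link. -/
theorem IsTree.incidence_mulVec_injective {G : DiMultigraph V E} (hG : G.IsTree) :
    Function.Injective fun f : E → ℝ => G.incidence *ᵥ f := by
  intro f g hfg
  rw [← sub_eq_zero]
  funext i
  obtain ⟨S, h1, h2, h3⟩ := hG.exists_fundamental_cut i
  have h := G.sum_incidence_mulVec (f - g) S
  rw [Matrix.mulVec_sub, sub_eq_zero.mpr hfg, Finset.sum_eq_single i] at h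
  · simpa [h1, h2] using h.symm
  · intro j _ hj
    simp [h3 j hj]
  · simp

theorem IsTree.exists_feasible {G : DiMultigraph V E} (hG : G.IsTree) {wl wu cl cu f : E → ℝ}
    (hwlu : wl ≤ wu) (hwu : ∀ i, 0 < wu i) (hl : cl ≤ f) (hu : f ≤ cu) :
    ∃ w, G.Feasible wl wu cl cu (G.incidence *ᵥ f) w := by
  obtain ⟨g, hg⟩ := powerFlowSolvable_of_pos hG.1.connected hwu (G.sum_univ_incidence_mulVec f)
  obtain rfl : g = f := hG.incidence_mulVec_injective hg.1
  -- The upper weights are positive, whereas `wl` may vanish.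
  exact ⟨wu, hg.feasible (fun i => (hwu i).le) hwlu le_rfl hl hu⟩

omit [DecidableEq E] in
theorem WeaklyConnected.exists_crossing {G : DiMultigraph V E} (hG : G.WeaklyConnected)
    {S : Finset V} (h1 : S.Nonempty) (h2 : S ≠ Finset.univ) :
    ∃ i, (G.tail i ∈ S ∧ G.head i ∉ S) ∨ (G.head i ∈ S ∧ G.tail i ∉ S) := by
  by_contra! h
  obtain ⟨a, ha⟩ := h1
  refine h2 (Finset.eq_univ_iff_forall.mpr fun v => ?_)
  obtain ⟨q⟩ := hG.preconnected a v
  induction q with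
  | nil => exact ha
  | cons hadj _ ih =>
    refine ih ?_
    obtain ⟨i, ⟨rfl, rfl⟩ | ⟨rfl, rfl⟩⟩ := hadj
    · exact (h i).1 ha
    · exact (h i).2 ha

/-- A fundamental cut and its complement realize the two residual capacities of a link. Conversely,
every cut is crossed by some link, and the other terms are nonnegative. -/
theorem IsTree.minCut_flowGraph [Nontrivial V] {G : DiMultigraph V E} (hG : G.IsTree)
    {cl cu f₀ : E → ℝ} (hl : cl ≤ f₀) (hu : f₀ ≤ cu) :
    G.flowGraph.minCut (flowCapacity cl cu f₀) = ⨅ i, min (f₀ i - cl i) (cu i - f₀ i) := by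
  have hbdd : BddBelow (Set.range fun i => min (f₀ i - cl i) (cu i - f₀ i)) :=
    (Set.finite_range _).bddBelow
  apply le_antisymm
  · obtain ⟨a, -⟩ := exists_pair_ne V
    have hE : Nonempty E := by
      obtain ⟨S, h1, h2⟩ := nonempty_cuts (V := V)
      obtain ⟨i, -⟩ := WeaklyConnected.exists_crossing hG.1.connected h1 h2
      exact ⟨i⟩
    refine le_ciInf fun i => ?_
    obtain ⟨S, h1, h2, h3⟩ := hG.exists_fundamental_cut i
    refine le_min ?_ ?_
    -- From the complement, the reversed copy of `i` is the one that leaves.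
    · refine (G.flowGraph.minCut_le_cutCapacity _ (S := Sᶜ) ⟨G.head i, by simpa using h2⟩
        fun h => ?_).trans_eq ?_
      · have := h ▸ Finset.mem_univ (G.tail i)
        exact Finset.mem_compl.mp this h1
      · rw [cutCapacity_flowGraph, Finset.sum_eq_single i]
        · simp [h1, h2]
        · intro j _ hj
          simp [h3 j hj]
        · simp
    · refine (G.flowGraph.minCut_le_cutCapacity _ ⟨G.tail i, h1⟩
        fun h => h2 (h ▸ Finset.mem_univ _)).trans_eq ?_
      rw [cutCapacity_flowGraph, Finset.sum_eq_single i]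
      · simp [h1, h2]
      · intro j _ hj
        simp [h3 j hj]
      · simp
  · refine le_ciInf fun ⟨S, h1, h2⟩ => ?_
    obtain ⟨i, hi⟩ := WeaklyConnected.exists_crossing hG.1.connected h1 h2
    refine (ciInf_le hbdd i).trans ?_
    rw [cutCapacity_flowGraph]
    refine le_trans ?_ (Finset.single_le_sum (fun j _ => ?_) (Finset.mem_univ i))
    · rcases hi with ⟨a, b⟩ | ⟨a, b⟩
      · simp [a, b]
      · simp [a, b]
    · have := hl j
      have := hu j
      refine add_nonneg ?_ ?_ <;> split_ifs <;> linarith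

end DiMultigraph

theorem mainTheorem1 {V E : Type*} [Fintype V] [Fintype E] [DecidableEq V] [DecidableEq E]
    [Nontrivial V]
    (G : DiMultigraph V E) (hG : G.WeaklyConnected)
    (wl wu cl cu : E → ℝ) (hwl : ∀ i, 0 ≤ wl i) (hwu : ∀ i, 0 < wu i)
    (hcl : ∀ i, cl i < 0) (hcu : ∀ i, 0 < cu i)
    (p₀ : V → ℝ) (hp₀ : ∑ v, p₀ v = 0)
    (w₀ : E → ℝ) (hw₀l : wl ≤ w₀) (hw₀u : w₀ ≤ wu)
    (hw₀ : G.PowerFlowSolvable w₀ p₀)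
    (f₀ : E → ℝ) (hf₀ : f₀ = G.powerFlow w₀ p₀) (hf₀l : cl ≤ f₀) (hf₀u : f₀ ≤ cu) :
    G.margin wl wu cl cu p₀ ≤
        ((2 * G.flowGraph.minCut (DiMultigraph.flowCapacity cl cu f₀) : ℝ) : EReal) ∧
      (G.IsTree ∨ wl = 0 →
        G.margin wl wu cl cu p₀ =
          ((2 * G.flowGraph.minCut (DiMultigraph.flowCapacity cl cu f₀) : ℝ) : EReal)) ∧
      (G.IsTree →
        G.margin wl wu cl cu p₀ =
          ((2 * ⨅ i : E, min (f₀ i - cl i) (cu i - f₀ i) : ℝ) : EReal)) := by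
  have hw₀0 : 0 ≤ w₀ := fun i => (hwl i).trans (hw₀l i)
  have hA : G.incidence *ᵥ f₀ = p₀ := hf₀ ▸ (hw₀.isPowerFlow hw₀0).1
  have hupper := G.margin_le_two_mul_minCut (wl := wl) (wu := wu) (cl := cl) (cu := cu) hA
  have heq : G.IsTree ∨ wl = 0 → G.margin wl wu cl cu p₀ =
      ((2 * G.flowGraph.minCut (DiMultigraph.flowCapacity cl cu f₀) : ℝ) : EReal) := by
    intro h
    refine le_antisymm hupper (G.two_mul_minCut_le_margin hf₀l hf₀u hA fun f hl hu => ?_)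
    rcases h with hT | rfl
    · exact hT.exists_feasible (hw₀l.trans hw₀u) hwu hl hu
    · exact G.exists_feasible_of_zero_le hwu hcl hcu hl hu
  refine ⟨hupper, heq, fun hT => ?_⟩
  rw [heq (Or.inl hT), hT.minCut_flowGraph hf₀l hf₀u]
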